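/- Let $n$ be a natural number and let $\mathbf{GL}_n(\mathbb C)$ be the group of invertible complex $n\times n$ matrices, an open subset of $\mathbb C^{n\times n}$ viewed as a real manifold of dimension $m=2n^2$. Equip it with the left-invariant semi-Riemannian metric $g$ that is given on the Lie algebra $\mathbb C^{n\times n}$ by $g(Z,W)=-\operatorname{Re}\operatorname{tr}(ZW)$, that is, $g_z(A,B)=-\operatorname{Re}\operatorname{tr}(z^{-1}A\,z^{-1}B)$ for tangent vectors $A,B\in\mathbb C^{n\times n}$ at $z$. On a semi-Riemannian manifold $(M,g)$, the Laplace-Beltrami operator (tension field) $\tau$ and the conformality operator $\kappa$ act on smooth functions $\phi,\psi:M\to\mathbb C$ by $\tau(\phi)=\operatorname{div}(\nabla\phi)$ and $\kappa(\phi,\psi)=g(\nabla\phi,\nabla\psi)$, where $g$ is extended complex-bilinearly to the complexified tangent bundle; in local coordinates $$\tau(\phi)=\sum_{i,j=1}^m\frac1{\sqrt{|g|}}\frac{\partial}{\partial x_j}\Big(g^{ij}\sqrt{|g|}\,\frac{\partial\phi}{\partial x_i}\Big),\qquad \kappa(\phi,\psi)=\sum_{i,j=1}^m g^{ij}\,\frac{\partial\phi}{\partial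 x_i}\frac{\partial\psi}{\partial x_j},$$ where $|g|=|\det(g_{ij})|$. A set $\mathcal E$ of smooth functions $M\to\mathbb C$ is an eigenfamily on $M$ if there are $\lambda,\mu\in\mathbb C$ such that $\tau(\phi)=\lambda\phi$ and $\kappa(\phi,\psi)=\mu\,\phi\psi$ for all $\phi,\psi\in\mathcal E$. **Theorem.** Let $v$ be a non-zero element of $\mathbb C^n$ (elements of $\mathbb C^n$ are row vectors). Then $$\mathcal E_v=\{\phi_a:\mathbf{GL}_n(\mathbb C)\to\mathbb C \mid \phi_a(z)=\operatorname{tr}(v^t a z^t),\ a\in\mathbb C^n\}$$ is a complex vector space of dimension $n$ (a linear subspace of the space of functions $\mathbf{GL}_n(\mathbb C)\to\mathbb C$) and an eigenfamily on $\mathbf{GL}_n(\mathbb C)$, and for all $\phi,\psi\in\mathcal E_v$ $$\tau(\phi)=-2n\,\phi\qquad\text{and}\qquad \kappa(\phi,\psi)=-2\,\phi\,\psi .$$ -/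

import Mathlib

open scoped Manifold ContDiff Matrix
open Bundle

noncomputable section

/-- The index of a symmetric bilinear form: the largest dimension of a subspace on which it is
negative definite (the spaces below are finite-dimensional). -/
def bilinIndex {V : Type*} [AddCommGroup V] [Module ℝ V] (B : V → V → ℝ) : ℕ :=
  sSup {d : ℕ | ∃ W : Submodule ℝ V, Module.finrank ℝ W = d ∧ ∀ w ∈ W, w ≠ 0 → B w w < 0}

/-- A semi-Riemannian metric on a manifold `M` modelled on the finite-dimensional real vector
space `E`: a smooth field of symmetric nondegenerate bilinear forms of constant index on the
tangent spaces. -/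
structure SemiRiemannianMetric (E : Type*) [NormedAddCommGroup E] [NormedSpace ℝ E]
    [FiniteDimensional ℝ E]
    (M : Type*) [TopologicalSpace M] [ChartedSpace E M] [IsManifold 𝓘(ℝ, E) ∞ M] where
  /-- The scalar product on the tangent space at `x`. -/
  inner (x : M) : TangentSpace 𝓘(ℝ, E) x →L[ℝ] TangentSpace 𝓘(ℝ, E) x →L[ℝ] ℝ
  symm (x : M) (v w : TangentSpace 𝓘(ℝ, E) x) : inner x v w = inner x w v
  nondegenerate (x : M) (v : TangentSpace 𝓘(ℝ, E) x) (hv : ∀ w, inner x v w = 0) : v = 0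
  index_eq (x y : M) :
    bilinIndex (fun v w ↦ inner x v w) = bilinIndex (fun v w ↦ inner y v w)
  contMDiff : ContMDiff 𝓘(ℝ, E) (𝓘(ℝ, E).prod 𝓘(ℝ, E →L[ℝ] E →L[ℝ] ℝ)) ∞
    (fun x ↦ TotalSpace.mk' (E →L[ℝ] E →L[ℝ] ℝ)
      (E := fun x : M ↦ TangentSpace 𝓘(ℝ, E) x →L[ℝ] TangentSpace 𝓘(ℝ, E) x →L[ℝ] ℝ)
      x (inner x))

namespace SemiRiemannianMetric

variable {E : Type*} [NormedAddCommGroup E] [NormedSpace ℝ E] [FiniteDimensional ℝ E]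
  {M : Type*} [TopologicalSpace M] [ChartedSpace E M]

/-! A chart `e` followed by a linear basis of the model space `E` is a system of local coordinates
`x₁, …, xₘ`; functions on `M` are expressed on the image of `e` in `E`. -/

/-- The coordinate partial derivative `∂f/∂xᵢ` of a complex-valued function on `E`. -/
def partialDeriv (i : Fin (Module.finrank ℝ E)) (f : E → ℂ) (y : E) : ℂ :=
  fderiv ℝ f y (Module.finBasis ℝ E i)

/-- The coordinate vector field `∂/∂xᵢ` of the chart `e`, at the point with coordinates `y`. -/
def coordVector (e : OpenPartialHomeomorph M E)
    (i : Fin (Module.finrank ℝ E)) (y : E) : TangentSpace 𝓘(ℝ, E) (e.symm y) :=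
  mfderiv 𝓘(ℝ, E) 𝓘(ℝ, E) e.symm y (Module.finBasis ℝ E i)

variable [IsManifold 𝓘(ℝ, E) ∞ M] (g : SemiRiemannianMetric E M)

/-- The matrix `g_{ij} = g(∂/∂xᵢ, ∂/∂xⱼ)` of the metric in the chart `e`. -/
def gram (e : OpenPartialHomeomorph M E) (y : E) :
    Matrix (Fin (Module.finrank ℝ E)) (Fin (Module.finrank ℝ E)) ℝ :=
  Matrix.of fun i j ↦ g.inner (e.symm y) (coordVector e i y) (coordVector e j y)

/-- The density `√|g|` in the chart `e`, where `|g| = |det (g_{ij})|`. -/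
def density (e : OpenPartialHomeomorph M E) (y : E) : ℝ :=
  √|(g.gram e y).det|

/-- The `j`-th component `∑ᵢ g^{ij} ∂φ/∂xᵢ`, in the chart `e`, of the gradient `∇φ`, which is a
section of the complexified tangent bundle. -/
def gradComponent (e : OpenPartialHomeomorph M E) (φ : M → ℂ)
    (j : Fin (Module.finrank ℝ E)) (y : E) : ℂ :=
  ∑ i, (((g.gram e y)⁻¹ i j : ℝ) : ℂ) * partialDeriv i (φ ∘ e.symm) y

/-- The Laplace-Beltrami operator (tension field) `τ(φ) = div (∇φ)`, that is
`∑_{i,j} (1/√|g|) ∂/∂xⱼ (g^{ij} √|g| ∂φ/∂xᵢ)`, computed at `p` in the preferred chart at `p`. -/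
def tension (φ : M → ℂ) (p : M) : ℂ :=
  ∑ j, (1 / (g.density (chartAt E p) (chartAt E p p) : ℂ)) *
    partialDeriv j
      (fun y ↦ (g.density (chartAt E p) y : ℂ) * g.gradComponent (chartAt E p) φ j y)
      (chartAt E p p)

/-- The conformality operator `κ(φ,ψ) = g(∇φ,∇ψ)`, with `g` extended complex-bilinearly to the
complexified tangent spaces, computed at `p` in the preferred chart at `p`. -/
def conformality (φ ψ : M → ℂ) (p : M) : ℂ :=
  ∑ i, ∑ j, (g.gram (chartAt E p) (chartAt E p p) i j : ℂ) *
    g.gradComponent (chartAt E p) φ i (chartAt E p p) *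
    g.gradComponent (chartAt E p) ψ j (chartAt E p p)

/-- An eigenfamily: a set of smooth complex-valued functions on `M` with common constants
`lam, mu` such that `τ(φ) = lam φ` and `κ(φ,ψ) = mu φ ψ` for all its members. -/
def IsEigenfamily (F : Set (M → ℂ)) : Prop :=
  (∀ φ ∈ F, ContMDiff 𝓘(ℝ, E) 𝓘(ℝ, ℂ) ∞ φ) ∧
  ∃ lam mu : ℂ, ∀ φ ∈ F, ∀ ψ ∈ F,
    (∀ p, g.tension φ p = lam * φ p) ∧ (∀ p, g.conformality φ ψ p = mu * φ p * ψ p)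

end SemiRiemannianMetric

/-! ### Left-invariant metrics on the group of units of a finite-dimensional algebra

The group of units `Rˣ` is an open subset of `R`, with the inclusion as the only preferred chart;
its tangent spaces, and its Lie algebra, are thus copies of `R`. -/

section Units

variable {R : Type*} [NormedRing R] [NormedAlgebra ℝ R]

/-- The bilinear form `(A, B) ↦ b (a A) (a B)` on `R`. -/
def translateForm (b : R →L[ℝ] R →L[ℝ] ℝ) (a : R) : R →L[ℝ] R →L[ℝ] ℝ :=
  ((b.comp (ContinuousLinearMap.mul ℝ R a)).flip.comp (ContinuousLinearMap.mul ℝ R a)).flip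

lemma translateForm_apply (b : R →L[ℝ] R →L[ℝ] ℝ) (a A B : R) :
    translateForm b a A B = b (a * A) (a * B) := rfl

set_option synthInstance.maxHeartbeats 400000 in
set_option maxHeartbeats 1000000 in
lemma translateForm_contDiff (b : R →L[ℝ] R →L[ℝ] ℝ) : ContDiff ℝ ∞ (translateForm b) := by
  have h : ContDiff ℝ ∞ fun a : R ↦ ContinuousLinearMap.mul ℝ R a :=
    ContinuousLinearMap.contDiff _
  have hflip : ContDiff ℝ ∞ fun c : R →L[ℝ] R →L[ℝ] ℝ ↦ c.flip := by
    have := LinearIsometryEquiv.contDiff (𝕜 := ℝ) (n := ∞)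
      (E := R →L[ℝ] R →L[ℝ] ℝ) (F := R →L[ℝ] R →L[ℝ] ℝ) (ContinuousLinearMap.flipₗᵢ ℝ R R ℝ)
    exact this
  have h1 : ContDiff ℝ ∞ fun a : R ↦ b.comp (ContinuousLinearMap.mul ℝ R a) :=
    contDiff_const.clm_comp h
  have h2 : ContDiff ℝ ∞ fun a : R ↦
      (b.comp (ContinuousLinearMap.mul ℝ R a)).flip.comp (ContinuousLinearMap.mul ℝ R a) :=
    (hflip.comp h1).clm_comp h
  exact hflip.comp h2

lemma translateForm_symm (b : R →L[ℝ] R →L[ℝ] ℝ) (hsymm : ∀ v w, b v w = b w v) (z : Rˣ)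
    (A B : R) : translateForm b z.val A B = translateForm b z.val B A := hsymm _ _

lemma translateForm_nondegenerate (b : R →L[ℝ] R →L[ℝ] ℝ)
    (hnondeg : ∀ v, (∀ w, b v w = 0) → v = 0) (z : Rˣ) (A : R)
    (h : ∀ B, translateForm b z.val A B = 0) : A = 0 := by
  have h1 : z.val * A = 0 := by
    apply hnondeg
    intro W
    have h2 := h (z⁻¹.val * W)
    rwa [translateForm_apply, Units.mul_inv_cancel_left] at h2
  simpa using h1

lemma bilinIndex_translateForm (b : R →L[ℝ] R →L[ℝ] ℝ) (z : Rˣ) :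
    bilinIndex (fun v w ↦ translateForm b z.val v w) = bilinIndex (fun v w ↦ b v w) := by
  let f : R ≃ₗ[ℝ] R :=
    { LinearMap.mulLeft ℝ z.val with
      invFun := fun X ↦ z⁻¹.val * X
      left_inv := fun X ↦ by simp
      right_inv := fun X ↦ by simp }
  have hf (v w) : translateForm b z.val v w = b (f v) (f w) := rfl
  simp only [bilinIndex, hf]
  congr 1
  ext d
  constructor
  · rintro ⟨W, rfl, hW⟩
    refine ⟨W.map f.toLinearMap, LinearEquiv.finrank_map_eq f W, ?_⟩
    rintro _ ⟨w, hw, rfl⟩ h0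
    exact hW w hw (by rintro rfl; simp at h0)
  · rintro ⟨W, rfl, hW⟩
    refine ⟨W.map f.symm.toLinearMap, LinearEquiv.finrank_map_eq f.symm W, ?_⟩
    rintro _ ⟨w, hw, rfl⟩ h0
    simpa using hW w hw (by rintro rfl; simp at h0)

variable [CompleteSpace R]

lemma units_symmL (x z : Rˣ) :
    (trivializationAt R (TangentSpace 𝓘(ℝ, R)) x).symmL ℝ z = ContinuousLinearMap.id ℝ R := by
  rw [TangentBundle.symmL_trivializationAt_eq_core (by simp)]
  ext v
  exact (tangentBundleCore 𝓘(ℝ, R) Rˣ).coordChange_self (achart R x) z (by simp) v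

lemma units_contMDiff_section
    (f : ∀ x : Rˣ, TangentSpace 𝓘(ℝ, R) x →L[ℝ] TangentSpace 𝓘(ℝ, R) x →L[ℝ] ℝ)
    (f' : Rˣ → R →L[ℝ] R →L[ℝ] ℝ) (hff : ∀ x v w, f x v w = f' x v w)
    (hf : ContMDiff 𝓘(ℝ, R) 𝓘(ℝ, R →L[ℝ] R →L[ℝ] ℝ) ∞ f') :
    ContMDiff 𝓘(ℝ, R) (𝓘(ℝ, R).prod 𝓘(ℝ, R →L[ℝ] R →L[ℝ] ℝ)) ∞
      (fun x ↦ TotalSpace.mk' (R →L[ℝ] R →L[ℝ] ℝ)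
        (E := fun x : Rˣ ↦ TangentSpace 𝓘(ℝ, R) x →L[ℝ] TangentSpace 𝓘(ℝ, R) x →L[ℝ] ℝ)
        x (f x)) := by
  intro x
  rw [contMDiffAt_section]
  convert! hf x
  rename_i z
  ext v w
  rw [hom_trivializationAt_apply]
  refine Eq.trans ?_ (hff z v w)
  have h (u : R) : (trivializationAt R (TangentSpace 𝓘(ℝ, R)) x).symm z u = u := by
    rw [← Trivialization.symmL_apply (R := ℝ) _ (by simp)]
    exact congrArg (fun L : R →L[ℝ] R ↦ L u) (units_symmL x z)
  simp [ContinuousLinearMap.inCoordinates, hom_trivializationAt_apply, h]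

/-- The left-invariant semi-Riemannian metric on `Rˣ` given by a symmetric nondegenerate bilinear
form `b` on the Lie algebra `R`: left translation by `z⁻¹` takes a tangent vector `A` at `z` to
`z⁻¹ A`, so the scalar product of `A` and `B` at `z` is `b (z⁻¹ A) (z⁻¹ B)`. -/
def leftInvariantMetric [FiniteDimensional ℝ R] (b : R →L[ℝ] R →L[ℝ] ℝ) (hsymm : ∀ v w, b v w = b w v)
    (hnondeg : ∀ v, (∀ w, b v w = 0) → v = 0) : SemiRiemannianMetric R Rˣ where
  inner z := translateForm (R := R) b z⁻¹.val
  symm z A B := translateForm_symm b hsymm z⁻¹ A B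
  nondegenerate z A h := translateForm_nondegenerate b hnondeg z⁻¹ A h
  index_eq x y := (bilinIndex_translateForm b x⁻¹).trans (bilinIndex_translateForm b y⁻¹).symm
  contMDiff := units_contMDiff_section _ (fun z ↦ translateForm b z⁻¹.val) (fun _ _ _ ↦ rfl)
    ((translateForm_contDiff b).contMDiff.comp
      (Units.contMDiff_val.comp (contMDiff_inv 𝓘(ℝ, R) ∞)))

end Units

/-! ### The complex general linear group -/

/-- The algebra of complex `n × n` matrices, equipped with a norm (the operator norm for the
sup norm on `ℂⁿ`), so that it is a finite-dimensional normed space and can model a manifold. All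
norms are equivalent; the choice only provides the usual topology and smooth structure. -/
def MatC (n : ℕ) : Type := Matrix (Fin n) (Fin n) ℂ

section MatCInstances

open scoped Matrix.Norms.Operator

instance MatC.instNormedRing (n : ℕ) : NormedRing (MatC n) :=
  inferInstanceAs (NormedRing (Matrix (Fin n) (Fin n) ℂ))

instance MatC.instNormedAlgebra (n : ℕ) : NormedAlgebra ℝ (MatC n) :=
  inferInstanceAs (NormedAlgebra ℝ (Matrix (Fin n) (Fin n) ℂ))

end MatCInstances

/-- The identity, from `MatC n` to the algebra of matrices. -/
def MatC.toMatrix {n : ℕ} : MatC n ≃ₐ[ℝ] Matrix (Fin n) (Fin n) ℂ := AlgEquiv.refl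

instance MatC.instFiniteDimensional (n : ℕ) : FiniteDimensional ℝ (MatC n) :=
  Module.Finite.equiv (MatC.toMatrix (n := n)).toLinearEquiv.symm

instance MatC.instCompleteSpace (n : ℕ) : CompleteSpace (MatC n) :=
  FiniteDimensional.complete ℝ _

/-- The complex general linear group: the group of units of the algebra of complex `n × n`
matrices. Its manifold structure is that of an open subset of this algebra, with the inclusion as
the only preferred chart. -/
abbrev GLC (n : ℕ) : Type := (MatC n)ˣ

section GLC

variable (n : ℕ)

/-- The bilinear form `(Z, W) ↦ -Re tr (Z W)` on the space of complex `n × n` matrices. -/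
def glForm : MatC n →L[ℝ] MatC n →L[ℝ] ℝ :=
  LinearMap.toContinuousBilinearMap <|
    LinearMap.mk₂ ℝ (fun Z W : MatC n ↦ -(MatC.toMatrix (Z * W)).trace.re)
      (by intros; simp [add_mul]; ring) (by intros; simp)
      (by intros; simp [mul_add]; ring) (by intros; simp)

lemma glForm_apply (Z W : MatC n) :
    glForm n Z W = -(MatC.toMatrix (Z * W)).trace.re := rfl

lemma glForm_symm (Z W : MatC n) : glForm n Z W = glForm n W Z := by
  rw [glForm_apply, glForm_apply, map_mul, map_mul, Matrix.trace_mul_comm]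

open scoped ComplexOrder in
lemma glForm_nondegenerate (Z : MatC n) (h : ∀ W, glForm n Z W = 0) : Z = 0 := by
  have h1 := h (MatC.toMatrix.symm (MatC.toMatrix Z)ᴴ)
  rw [glForm_apply, neg_eq_zero, map_mul, AlgEquiv.apply_symm_apply] at h1
  have h2 : ((MatC.toMatrix Z) * (MatC.toMatrix Z)ᴴ).trace = 0 := by
    apply Complex.ext h1
    have := Matrix.trace_conjTranspose ((MatC.toMatrix Z) * (MatC.toMatrix Z)ᴴ)
    rw [Matrix.conjTranspose_mul, Matrix.conjTranspose_conjTranspose] at this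
    have := congrArg Complex.im this
    rw [Complex.star_def, Complex.conj_im] at this
    rw [Complex.zero_im]
    linarith
  have h3 := Matrix.trace_mul_conjTranspose_self_eq_zero_iff.1 h2
  simpa using h3

/-- The natural semi-Riemannian metric on the complex general linear group: the left-invariant
metric given by `-Re tr (Z W)` on the Lie algebra. -/
def glMetric : SemiRiemannianMetric (MatC n) (GLC n) :=
  leftInvariantMetric (glForm n) (glForm_symm n) (glForm_nondegenerate n)

/-- The set `E_v` of the functions `φ_a(z) = tr (vᵗ a zᵗ)` on the general linear group, where
`a` ranges over `ℂⁿ`; elements of `ℂⁿ` are row vectors, so that `vᵗ a` is the matrix `(vᵢ aⱼ)`. -/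
def glFamily (v : Fin n → ℂ) : Set (GLC n → ℂ) :=
  Set.range fun (a : Fin n → ℂ) (z : GLC n) ↦
    (Matrix.vecMulVec v a * (MatC.toMatrix (z : MatC n))ᵀ).trace

end GLC

end

noncomputable section

/-! The units of a finite-dimensional real algebra are open in it, so linear coordinates serve
everywhere. For a left-invariant metric with form `b`, the Gram matrix at `u` is the pullback of
that of `b` under left multiplication by `u⁻¹`. Hence the density is a constant times `|det
L_{u⁻¹}|`, its logarithmic derivative at `p` is `X ↦ -tr L_{p⁻¹X}`, and the divergence of a vector
field `V` is `tr V'(p) - tr L_{p⁻¹V(p)}` (`hasFDerivAt_density`, `IsGradient.tension`).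

If moreover `b(XY, Z) = b(X, YZ)`, the linear function `z ↦ b(M, z)` has gradient `zMz`
(`isGradient_of_linear`). The derivative of this field is `L_{zM} + R_{Mz}`. For matrices `tr
L_{zM}` cancels against `tr L_{Mz}`, and `tr R_{Mz} = 2n Re tr(Mz)` is left. Each `φ_a` is `z ↦
tr(Nz)` with `N` the rank-one matrix `(aᵢ vⱼ)`; its real and imaginary parts are linear functions of
the above kind with `M = -N` and `M = iN`, which gives `τ(φ_a) = -2n φ_a`.

The conformality operator is `dψ(∇φ)`, which here equals `-2 tr(N_c z N_a z)`. Since `N_a` and `N_c`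
have rank one with the same row `v`, this trace factors into `φ_a φ_c` (`trace_vecMulVec_sandwich`).
The dimension is `n` because enough invertible matrices exist to recover `a` from `φ_a`
(`familyMap_injective`). -/

namespace UnitsMetric

open SemiRiemannianMetric Filter Topology

/-! ### The determinant of left multiplication and its derivative at `1`. -/

section Determinant

variable {R : Type*} [NormedRing R] [NormedAlgebra ℝ R]

/-- The real determinant of left multiplication by `y`. -/
def leftDet (y : R) : ℝ := LinearMap.det (LinearMap.mulLeft ℝ y)

lemma leftDet_mul (x y : R) : leftDet (x * y) = leftDet x * leftDet y := by
  simp [leftDet, LinearMap.mulLeft_mul, LinearMap.det_comp]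

lemma leftDet_one : leftDet (1 : R) = 1 := by
  simp [leftDet, LinearMap.mulLeft_one]

lemma leftDet_mul_leftDet_inv (u : Rˣ) : leftDet (u : R) * leftDet ((u⁻¹ : Rˣ) : R) = 1 := by
  rw [← leftDet_mul, Units.mul_inv, leftDet_one]

lemma leftDet_ne_zero (u : Rˣ) : leftDet (u : R) ≠ 0 :=
  left_ne_zero_of_mul_eq_one (leftDet_mul_leftDet_inv u)

variable [FiniteDimensional ℝ R]

lemma differentiable_leftDet : Differentiable ℝ (leftDet : R → ℝ) := by
  have h (y : R) : leftDet y = (LinearMap.toMatrix (Module.finBasis ℝ R) (Module.finBasis ℝ R)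
      (LinearMap.mul ℝ R y)).det := by
    rw [LinearMap.det_toMatrix]; rfl
  have hL (i j) : Differentiable ℝ fun y : R ↦ LinearMap.toMatrix (Module.finBasis ℝ R)
      (Module.finBasis ℝ R) (LinearMap.mul ℝ R y) i j := by
    simp only [LinearMap.toMatrix_apply]
    exact (LinearMap.toContinuousLinearMap
      (((Module.finBasis ℝ R).coord i).comp
        ((LinearMap.mul ℝ R).flip (Module.finBasis ℝ R j)))).differentiable
  rw [funext h]
  simp only [Matrix.det_apply]
  fun_prop

/-- The trace of left multiplication, as a continuous linear form. -/
def leftTrace : R →L[ℝ] ℝ :=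
  LinearMap.toContinuousLinearMap ((LinearMap.trace ℝ R).comp (LinearMap.mul ℝ R))

lemma leftTrace_apply (x : R) : leftTrace x = LinearMap.trace ℝ R (LinearMap.mulLeft ℝ x) := rfl

/-- Differentiability is already known, so it suffices to compare derivatives along the lines `1 + t
x`. -/
lemma hasFDerivAt_leftDet_one : HasFDerivAt (leftDet : R → ℝ) leftTrace 1 := by
  have h := (differentiable_leftDet (R := R) 1).hasFDerivAt
  convert h using 1
  ext x
  have h1 : HasDerivAt (fun t : ℝ ↦ leftDet (1 + t • x)) (fderiv ℝ leftDet 1 x) 0 := by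
    have h2 : HasDerivAt (fun t : ℝ ↦ 1 + t • x) x 0 := by
      simpa using ((hasDerivAt_id (0 : ℝ)).smul_const x).const_add 1
    have h3 : HasFDerivAt (leftDet : R → ℝ) (fderiv ℝ leftDet 1) (1 + (0 : ℝ) • x) := by
      simpa using h
    exact h3.comp_hasDerivAt 0 h2
  let A := LinearMap.toMatrix (Module.finBasis ℝ R) (Module.finBasis ℝ R) (LinearMap.mulLeft ℝ x)
  -- `det (1 + tA) = 1 + t tr A + q(t) t²` with `q` a polynomial, so the remainder does not
  -- contribute at `t = 0`.
  have hA (t : ℝ) : leftDet (1 + t • x) = 1 + leftTrace x * t +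
      ((1 + (Polynomial.X : Polynomial ℝ) • A.map Polynomial.C).det.divX.divX).eval t * t ^ 2 := by
    have : leftDet (1 + t • x) = (1 + t • A).det := by
      rw [leftDet, ← LinearMap.det_toMatrix (Module.finBasis ℝ R)]
      congr 1
      have : LinearMap.mulLeft ℝ (1 + t • x) = LinearMap.id + t • LinearMap.mulLeft ℝ x := by
        ext; simp [add_mul]
      rw [this, map_add, map_smul, LinearMap.toMatrix_id]
    rw [this, Matrix.det_one_add_smul, leftTrace_apply,
      LinearMap.trace_eq_matrix_trace ℝ (Module.finBasis ℝ R)]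
  have h4 : HasDerivAt (fun t : ℝ ↦ leftDet (1 + t • x)) (leftTrace x) 0 := by
    rw [funext hA]
    have h5 := Polynomial.hasDerivAt
      ((1 + (Polynomial.X : Polynomial ℝ) • A.map Polynomial.C).det.divX.divX) 0
    have h6 := (((hasDerivAt_id (0 : ℝ)).const_mul (leftTrace x)).const_add 1).add
      (h5.mul (hasDerivAt_pow 2 (0 : ℝ)))
    convert! h6 using 1
    simp
  exact h4.unique h1

end Determinant

/-! ### The inclusion chart of the group of units. -/

section Coordinates

variable {R : Type*} [NormedRing R] [CompleteSpace R]

lemma chartAt_symm_val (p u : Rˣ) : (chartAt R p).symm (u : R) = u :=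
  (chartAt R p).left_inv (Set.mem_univ u)

lemma eventually_exists_unit (p : Rˣ) : ∀ᶠ y in 𝓝 (p : R), ∃ u : Rˣ, (u : R) = y :=
  Units.isOpen.mem_nhds p.isUnit

variable [NormedAlgebra ℝ R] [FiniteDimensional ℝ R]

/-- The inverse chart, read in the inclusion chart, is the identity near `u`, and so is its
derivative. -/
lemma coordVector_chartAt (p u : Rˣ) (i : Fin (Module.finrank ℝ R)) :
    (coordVector (chartAt R p) i (u : R) : R) = Module.finBasis ℝ R i := by
  have hmd : MDifferentiableAt 𝓘(ℝ, R) 𝓘(ℝ, R) (chartAt R p).symm (u : R) :=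
    mdifferentiableAt_atlas_symm (I := 𝓘(ℝ, R)) (chart_mem_atlas R p)
      ((chartAt R p).map_source (Set.mem_univ u))
  have h : writtenInExtChartAt 𝓘(ℝ, R) 𝓘(ℝ, R) (u : R) (chartAt R p).symm
      =ᶠ[𝓝 (u : R)] id := by
    filter_upwards [eventually_exists_unit u]
    rintro _ ⟨w, rfl⟩
    exact congrArg Units.val (chartAt_symm_val p w)
  refine (DFunLike.congr_fun hmd.mfderiv _).trans ?_
  have h2 : fderivWithin ℝ (writtenInExtChartAt 𝓘(ℝ, R) 𝓘(ℝ, R) (u : R) (chartAt R p).symm)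
      (Set.range 𝓘(ℝ, R)) (extChartAt 𝓘(ℝ, R) (u : R) (u : R)) = ContinuousLinearMap.id ℝ R := by
    simp only [extChartAt_model_space_eq_id, modelWithCornersSelf_coe, Set.range_id,
      fderivWithin_univ, PartialEquiv.refl_coe, id]
    rw [h.fderiv_eq, fderiv_id]
  exact DFunLike.congr_fun h2 _

end Coordinates

/-! ### The gradient as the solution of a linear system. -/

section Gradient

variable {E : Type*} [NormedAddCommGroup E] [NormedSpace ℝ E] [FiniteDimensional ℝ E]
  {M : Type*} [TopologicalSpace M] [ChartedSpace E M] [IsManifold 𝓘(ℝ, E) ∞ M]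
  (g : SemiRiemannianMetric E M)

/-- As row vectors, `dφ = X G` with `G` the Gram matrix; multiplying by `G⁻¹` on the right recovers
`X`. This avoids computing the inverse matrix. -/
lemma gradComponent_eq_of_partialDeriv (e : OpenPartialHomeomorph M E) (φ : M → ℂ) (y : E)
    (hdet : (g.gram e y).det ≠ 0) (X : Fin (Module.finrank ℝ E) → ℂ)
    (hX : ∀ i, partialDeriv i (φ ∘ e.symm) y = ∑ k, X k * (g.gram e y k i : ℂ))
    (j : Fin (Module.finrank ℝ E)) : g.gradComponent e φ j y = X j := by
  have h : (g.gram e y).map Complex.ofRealHom * ((g.gram e y)⁻¹).map Complex.ofRealHom = 1 := by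
    rw [← Matrix.map_mul, Matrix.mul_nonsing_inv _ (isUnit_iff_ne_zero.2 hdet),
      Matrix.map_one _ (map_zero _) (map_one _)]
  have h2 : X ᵥ* ((g.gram e y).map Complex.ofRealHom * ((g.gram e y)⁻¹).map Complex.ofRealHom) = X := by
    rw [h, Matrix.vecMul_one]
  rw [← Matrix.vecMul_vecMul] at h2
  refine Eq.trans ?_ (congrFun h2 j)
  rw [gradComponent, Matrix.vecMul, dotProduct]
  refine Finset.sum_congr rfl fun i _ ↦ ?_
  rw [hX, mul_comm]
  rfl

end Gradient

/-! ### The Gram determinant on the Lie algebra. -/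

section BilinearForm

variable {R : Type*} [NormedRing R] [NormedAlgebra ℝ R] (b : R →L[ℝ] R →L[ℝ] ℝ)

/-- A continuous bilinear form, as an algebraic one. -/
def toBilin : LinearMap.BilinForm ℝ R := LinearMap.mk₂ ℝ (fun v w ↦ b v w)
  (by simp) (by simp) (by simp) (by simp)

variable [FiniteDimensional ℝ R]

lemma toMatrix_toBilin_det_ne_zero (hs : ∀ v w, b v w = b w v)
    (hn : ∀ v, (∀ w, b v w = 0) → v = 0) :
    (LinearMap.BilinForm.toMatrix (Module.finBasis ℝ R) (toBilin b)).det ≠ 0 := by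
  rw [← LinearMap.BilinForm.nondegenerate_iff_det_ne_zero]
  exact ⟨hn, fun v h ↦ hn v fun w ↦ (hs v w).trans (h w)⟩

end BilinearForm

/-! ### Density, divergence and conformality for a left-invariant metric. -/

section LeftInvariant

/-- The coordinate sum in the divergence, after division by the density, in basis-free form: the
diagonal entries of `V'` add up to its trace, and the other terms reassemble `X` from its
coordinates. -/
lemma sum_repr_sub_leftTrace {R : Type*} [NormedRing R] [NormedAlgebra ℝ R] [FiniteDimensional ℝ R]
    (p : Rˣ) (V' : R →L[ℝ] R) (X : R) :
    ∑ j, ((LinearMap.toContinuousLinearMap ((Module.finBasis ℝ R).coord j)).comp V' -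
          (Module.finBasis ℝ R).repr X j •
            leftTrace.comp (ContinuousLinearMap.mul ℝ R p⁻¹.val)) (Module.finBasis ℝ R j) =
      LinearMap.trace ℝ R V' - leftTrace (p⁻¹.val * X) := by
  have h1 : leftTrace (p⁻¹.val * X) = ∑ j, (Module.finBasis ℝ R).repr X j *
      leftTrace (p⁻¹.val * Module.finBasis ℝ R j) := by
    conv_lhs => rw [← (Module.finBasis ℝ R).sum_repr X]
    simp only [Finset.mul_sum, map_sum, mul_smul_comm, map_smul, smul_eq_mul]
  rw [h1, LinearMap.trace_eq_matrix_trace ℝ (Module.finBasis ℝ R), Matrix.trace,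
    ← Finset.sum_sub_distrib]
  refine Finset.sum_congr rfl fun j _ ↦ ?_
  simp [LinearMap.toMatrix_apply]

variable {R : Type*} [NormedRing R] [NormedAlgebra ℝ R] [CompleteSpace R] [FiniteDimensional ℝ R]
  (b : R →L[ℝ] R →L[ℝ] ℝ) (hs : ∀ v w, b v w = b w v) (hn : ∀ v, (∀ w, b v w = 0) → v = 0)

lemma gram_apply (p u : Rˣ) (i j : Fin (Module.finrank ℝ R)) :
    (leftInvariantMetric b hs hn).gram (chartAt R p) (u : R) i j =
      b (u⁻¹.val * Module.finBasis ℝ R i) (u⁻¹.val * Module.finBasis ℝ R j) := by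
  have h {x y : Rˣ} (hxy : x = y) {A B A' B' : R} (hA : A = A') (hB : B = B') :
      translateForm b x⁻¹.val A B = b (y⁻¹.val * A') (y⁻¹.val * B') := by
    rw [hxy, hA, hB, translateForm_apply]
  exact h (chartAt_symm_val p u) (coordVector_chartAt p u i) (coordVector_chartAt p u j)

/-- The Gram matrix is `Lᵀ B L`, where `L` is the matrix of left multiplication by `u⁻¹` and `B`
that of `b`. -/
lemma gram_det (p u : Rˣ) :
    ((leftInvariantMetric b hs hn).gram (chartAt R p) (u : R)).det =
      leftDet u⁻¹.val ^ 2 * (LinearMap.BilinForm.toMatrix (Module.finBasis ℝ R) (toBilin b)).det := by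
  have h : (leftInvariantMetric b hs hn).gram (chartAt R p) (u : R) =
      LinearMap.BilinForm.toMatrix (Module.finBasis ℝ R)
        ((toBilin b).comp (LinearMap.mulLeft ℝ u⁻¹.val) (LinearMap.mulLeft ℝ u⁻¹.val)) := by
    ext i j
    rw [gram_apply, LinearMap.BilinForm.toMatrix_apply]
    rfl
  rw [h, LinearMap.BilinForm.toMatrix_comp (Module.finBasis ℝ R), Matrix.det_mul, Matrix.det_mul,
    Matrix.det_transpose, LinearMap.det_toMatrix, ← leftDet]
  ring

lemma gram_det_ne_zero (p u : Rˣ) :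
    ((leftInvariantMetric b hs hn).gram (chartAt R p) (u : R)).det ≠ 0 := by
  rw [gram_det]
  exact mul_ne_zero (pow_ne_zero _ (leftDet_ne_zero _)) (toMatrix_toBilin_det_ne_zero b hs hn)

lemma density_eq (p u : Rˣ) :
    (leftInvariantMetric b hs hn).density (chartAt R p) (u : R) =
      √|(LinearMap.BilinForm.toMatrix (Module.finBasis ℝ R) (toBilin b)).det| *
        |leftDet u⁻¹.val| := by
  rw [density, gram_det, abs_mul, mul_comm, Real.sqrt_mul (abs_nonneg _), abs_pow, Real.sqrt_sq
    (abs_nonneg _)]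

lemma density_ne_zero (p u : Rˣ) :
    (leftInvariantMetric b hs hn).density (chartAt R p) (u : R) ≠ 0 :=
  Real.sqrt_ne_zero'.2 (abs_pos.2 (gram_det_ne_zero b hs hn p u))

lemma hasFDerivAt_density (p : Rˣ) :
    HasFDerivAt ((leftInvariantMetric b hs hn).density (chartAt R p))
      (-((leftInvariantMetric b hs hn).density (chartAt R p) (p : R) •
        (leftTrace.comp (ContinuousLinearMap.mul ℝ R p⁻¹.val)))) (p : R) := by
  set ρ := (leftInvariantMetric b hs hn).density (chartAt R p) with hρ
  have h1 : HasFDerivAt (fun y : R ↦ leftDet (p⁻¹.val * y))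
      (leftTrace.comp (ContinuousLinearMap.mul ℝ R p⁻¹.val)) (p : R) := by
    have hd : HasFDerivAt (leftDet : R → ℝ) leftTrace (ContinuousLinearMap.mul ℝ R p⁻¹.val p) := by
      simpa using hasFDerivAt_leftDet_one
    exact hd.comp (p : R) (ContinuousLinearMap.mul ℝ R p⁻¹.val).hasFDerivAt
  have hval : leftDet (p⁻¹.val * (p : R)) = 1 := by simp [leftDet_one]
  have h2 : HasFDerivAt (fun y : R ↦ ρ p * (leftDet (p⁻¹.val * y))⁻¹)
      (-(ρ p • (leftTrace.comp (ContinuousLinearMap.mul ℝ R p⁻¹.val)))) (p : R) := by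
    have hinv : HasDerivAt (fun t : ℝ ↦ ρ p * t⁻¹) (-ρ p) (leftDet (p⁻¹.val * (p : R))) := by
      rw [hval]
      simpa using (hasDerivAt_inv (one_ne_zero (α := ℝ))).const_mul (ρ p)
    have := hinv.comp_hasFDerivAt (p : R) h1
    rwa [neg_smul] at this
  refine h2.congr_of_eventuallyEq ?_
  -- Near `p` the determinant of `p⁻¹y` is close to `1`, hence positive, and the absolute value in
  -- the density can be dropped.
  have hpos : ∀ᶠ y in 𝓝 (p : R), 0 < leftDet (p⁻¹.val * y) :=
    h1.continuousAt.eventually_mem (Ioi_mem_nhds (by rw [hval]; exact one_pos))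
  filter_upwards [eventually_exists_unit p, hpos]
  rintro _ ⟨u, rfl⟩ hu
  rw [hρ, density_eq, density_eq, mul_assoc]
  congr 1
  have h3 : leftDet u⁻¹.val = leftDet p⁻¹.val * (leftDet (p⁻¹.val * u))⁻¹ := by
    rw [leftDet_mul, mul_inv, ← mul_assoc, mul_inv_cancel₀ (leftDet_ne_zero _), one_mul]
    exact eq_inv_of_mul_eq_one_right (leftDet_mul_leftDet_inv u)
  rw [h3, abs_mul, abs_of_pos (inv_pos.2 hu)]

/-- The real and imaginary parts of the gradient of `φ` are the vector fields `V` and `W`. -/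
def IsGradient (φ : Rˣ → ℂ) (V W : R → R) : Prop :=
  ∀ p u : Rˣ, ∀ X : R, fderiv ℝ (φ ∘ (chartAt R p).symm) (u : R) X =
    (b (u⁻¹.val * V u) (u⁻¹.val * X) : ℂ) + Complex.I * (b (u⁻¹.val * W u) (u⁻¹.val * X) : ℂ)

variable {b} {φ : Rˣ → ℂ} {V W : R → R}

lemma IsGradient.gradComponent (h : IsGradient b φ V W) (p u : Rˣ)
    (j : Fin (Module.finrank ℝ R)) :
    (leftInvariantMetric b hs hn).gradComponent (chartAt R p) φ j (u : R) =
      ((Module.finBasis ℝ R).repr (V u) j : ℂ) +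
        Complex.I * ((Module.finBasis ℝ R).repr (W u) j : ℂ) := by
  refine gradComponent_eq_of_partialDeriv _ _ φ _ (gram_det_ne_zero b hs hn p u)
    (fun k ↦ ((Module.finBasis ℝ R).repr (V u) k : ℂ) +
        Complex.I * ((Module.finBasis ℝ R).repr (W u) k : ℂ)) (fun i ↦ ?_) j
  have hsum (X : R) : b (u⁻¹.val * X) (u⁻¹.val * Module.finBasis ℝ R i) =
      ∑ k, (Module.finBasis ℝ R).repr X k *
        (leftInvariantMetric b hs hn).gram (chartAt R p) (u : R) k i := by
    conv_lhs => rw [← (Module.finBasis ℝ R).sum_repr X]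
    simp only [gram_apply, Finset.mul_sum, map_sum, mul_smul_comm, map_smul,
      sum_apply, smul_apply, smul_eq_mul]
  rw [partialDeriv, h p u, hsum, hsum]
  push_cast
  simp only [add_mul, Finset.sum_add_distrib, Finset.mul_sum, mul_assoc]

/-- By the defining property of `∇ψ`, `g(∇φ, ∇ψ) = dψ(∇φ)`, extended complex-linearly to `∇φ = V +
iW`. -/
theorem IsGradient.conformality (h : IsGradient b φ V W) {ψ : Rˣ → ℂ} {V' W' : R → R}
    (h' : IsGradient b ψ V' W') (p : Rˣ) :
    (leftInvariantMetric b hs hn).conformality φ ψ p =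
      fderiv ℝ (ψ ∘ (chartAt R p).symm) (p : R) (V p) +
        Complex.I * fderiv ℝ (ψ ∘ (chartAt R p).symm) (p : R) (W p) := by
  have hsum (X Y : R) : b (p⁻¹.val * X) (p⁻¹.val * Y) =
      ∑ i, ∑ j, (leftInvariantMetric b hs hn).gram (chartAt R p) (p : R) i j *
        (Module.finBasis ℝ R).repr X i * (Module.finBasis ℝ R).repr Y j := by
    conv_lhs => rw [← (Module.finBasis ℝ R).sum_repr X, ← (Module.finBasis ℝ R).sum_repr Y]
    simp only [gram_apply, Finset.mul_sum, map_sum, mul_smul_comm, map_smul,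
      sum_apply, smul_apply, smul_eq_mul]
    rw [Finset.sum_comm]
    refine Finset.sum_congr rfl fun i _ ↦ Finset.sum_congr rfl fun j _ ↦ ?_
    ring
  rw [h' p p, h' p p, hs _ (p⁻¹.val * V p), hs _ (p⁻¹.val * V p), hs _ (p⁻¹.val * W p),
    hs _ (p⁻¹.val * W p), SemiRiemannianMetric.conformality, Units.chartAt_apply]
  simp only [h.gradComponent hs hn, h'.gradComponent hs hn, hsum]
  push_cast
  simp only [Finset.mul_sum, ← Finset.sum_add_distrib]
  refine Finset.sum_congr rfl fun i _ ↦ Finset.sum_congr rfl fun j _ ↦ ?_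
  ring

lemma hasFDerivAt_density_mul_repr (p : Rˣ) {V' : R →L[ℝ] R} (hV : HasFDerivAt V V' (p : R))
    (j : Fin (Module.finrank ℝ R)) :
    HasFDerivAt (fun y ↦ (leftInvariantMetric b hs hn).density (chartAt R p) y *
        (Module.finBasis ℝ R).repr (V y) j)
      ((leftInvariantMetric b hs hn).density (chartAt R p) (p : R) •
        ((LinearMap.toContinuousLinearMap ((Module.finBasis ℝ R).coord j)).comp V' -
          (Module.finBasis ℝ R).repr (V p) j •
            leftTrace.comp (ContinuousLinearMap.mul ℝ R p⁻¹.val))) (p : R) := by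
  have h1 : HasFDerivAt (fun y ↦ (Module.finBasis ℝ R).repr (V y) j)
      ((LinearMap.toContinuousLinearMap ((Module.finBasis ℝ R).coord j)).comp V') (p : R) :=
    (LinearMap.toContinuousLinearMap ((Module.finBasis ℝ R).coord j)).hasFDerivAt.comp (p : R) hV
  convert! (hasFDerivAt_density b hs hn p).mul h1 using 1
  rw [smul_sub, smul_neg, smul_smul, smul_smul, mul_comm, sub_eq_add_neg]

theorem IsGradient.tension (h : IsGradient b φ V W) (p : Rˣ) {V' W' : R →L[ℝ] R}
    (hV : HasFDerivAt V V' (p : R)) (hW : HasFDerivAt W W' (p : R)) :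
    (leftInvariantMetric b hs hn).tension φ p =
      ((LinearMap.trace ℝ R V' - leftTrace (p⁻¹.val * V p) : ℝ) : ℂ) +
        Complex.I * ((LinearMap.trace ℝ R W' - leftTrace (p⁻¹.val * W p) : ℝ) : ℂ) := by
  have hρ := density_ne_zero b hs hn p p
  -- The gradient components are known only at units; as these form an open set, that determines the
  -- derivative at `p`.
  have hj (j : Fin (Module.finrank ℝ R)) :
      HasFDerivAt (fun y ↦ ((leftInvariantMetric b hs hn).density (chartAt R p) y : ℂ) *
        (leftInvariantMetric b hs hn).gradComponent (chartAt R p) φ j y) _ (p : R) :=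
    ((Complex.ofRealCLM.hasFDerivAt.comp (p : R)
      (hasFDerivAt_density_mul_repr hs hn p hV j)).add
      ((Complex.ofRealCLM.hasFDerivAt.comp (p : R)
        (hasFDerivAt_density_mul_repr hs hn p hW j)).const_mul Complex.I)).congr_of_eventuallyEq
      (by
        filter_upwards [eventually_exists_unit p]
        rintro _ ⟨u, rfl⟩
        rw [h.gradComponent hs hn]
        simp
        ring)
  rw [SemiRiemannianMetric.tension, Units.chartAt_apply, ← sum_repr_sub_leftTrace p V' (V p),
    ← sum_repr_sub_leftTrace p W' (W p), Complex.ofReal_sum, Complex.ofReal_sum, Finset.mul_sum,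
    ← Finset.sum_add_distrib]
  refine Finset.sum_congr rfl fun j _ ↦ ?_
  have hρ' : ((leftInvariantMetric b hs hn).density (chartAt R p) (p : R) : ℂ) ≠ 0 :=
    Complex.ofReal_ne_zero.2 hρ
  rw [partialDeriv, (hj j).fderiv]
  simp only [add_apply, smul_apply, ContinuousLinearMap.comp_apply, Complex.ofRealCLM_apply,
    smul_eq_mul, Complex.ofReal_mul]
  field_simp

end LeftInvariant

/-! ### Gradients of linear functions for an associative form. -/

section AssociativeForm

variable {R : Type*} [NormedRing R] [NormedAlgebra ℝ R] [CompleteSpace R]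
  {b : R →L[ℝ] R →L[ℝ] ℝ}

/-- For an associative form `b`, the linear function `b M` has the gradient `z ↦ z M z`. -/
lemma isGradient_of_linear (hassoc : ∀ X Y Z, b (X * Y) Z = b X (Y * Z)) (M N : R) (φ : Rˣ → ℂ)
    (hφ : ∀ z : Rˣ, φ z = (b M z : ℂ) + Complex.I * (b N z : ℂ)) :
    IsGradient b φ (fun z ↦ z * M * z) (fun z ↦ z * N * z) := by
  intro p u X
  have hd : HasFDerivAt (φ ∘ (chartAt R p).symm) (Complex.ofRealCLM.comp (b M) +
      Complex.I • Complex.ofRealCLM.comp (b N)) (u : R) := by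
    refine HasFDerivAt.congr_of_eventuallyEq (ContinuousLinearMap.hasFDerivAt _) ?_
    filter_upwards [eventually_exists_unit u]
    rintro _ ⟨w, rfl⟩
    rw [Function.comp_apply, chartAt_symm_val, hφ]
    simp
  -- `u⁻¹(uKu) = Ku`, and associativity moves the remaining `u` across to cancel `u⁻¹`.
  have h (K : R) : b (u⁻¹.val * (u * K * u)) (u⁻¹.val * X) = b K X := by
    rw [mul_assoc, Units.inv_mul_cancel_left, hassoc, Units.mul_inv_cancel_left]
  rw [hd.fderiv, h, h]
  simp

end AssociativeForm

/-! ### The derivative of `z ↦ z M z` and its trace. -/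

section Sandwich

variable {R : Type*} [NormedRing R] [NormedAlgebra ℝ R]

lemma hasFDerivAt_mul_mul (M z : R) : HasFDerivAt (fun z : R ↦ z * M * z)
    ((ContinuousLinearMap.mul ℝ R) (z * M) + (ContinuousLinearMap.mul ℝ R).flip (M * z)) z := by
  convert! ((hasFDerivAt_id (𝕜 := ℝ) z).mul_const' M).mul' (hasFDerivAt_id (𝕜 := ℝ) z) using 1
  ext X
  simp [mul_assoc]

lemma trace_deriv_mul_mul (M z : R) :
    LinearMap.trace ℝ R ((ContinuousLinearMap.mul ℝ R) (z * M) +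
      (ContinuousLinearMap.mul ℝ R).flip (M * z) : R →L[ℝ] R) =
      LinearMap.trace ℝ R (LinearMap.mulLeft ℝ (z * M)) +
        LinearMap.trace ℝ R (LinearMap.mulRight ℝ (M * z)) := by
  rw [← map_add]
  rfl

end Sandwich

/-! ### Real traces of complex-linear maps on matrices. -/

section RealTrace

variable {ι : Type*} [Fintype ι] [DecidableEq ι]

/-- In the real basis of the matrix units and their multiples by `i`, each complex diagonal entry
contributes its real part twice. -/
lemma trace_real_eq (f : Matrix ι ι ℂ →ₗ[ℂ] Matrix ι ι ℂ) :
    LinearMap.trace ℝ _ (f.restrictScalars ℝ) =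
      2 * (∑ p : ι × ι, f (Matrix.single p.1 p.2 1) p.1 p.2).re := by
  let b := Complex.basisOneI.smulTower (Matrix.stdBasis ℂ ι ι)
  rw [LinearMap.trace_eq_matrix_trace ℝ b, Matrix.trace, Fintype.sum_prod_type,
    Finset.sum_comm]
  simp only [Matrix.diag_apply, LinearMap.toMatrix_apply, b, Module.Basis.smulTower_apply,
    Module.Basis.smulTower_repr, LinearMap.restrictScalars_apply, map_smul,
    Fin.sum_univ_two, Complex.re_sum, Finset.mul_sum]
  refine Finset.sum_congr rfl fun p _ ↦ ?_
  rw [← Matrix.stdBasis_eq_single ℂ p.1 p.2]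
  have hrepr (Z : Matrix ι ι ℂ) : (Matrix.stdBasis ℂ ι ι).repr Z p = Z p.1 p.2 := rfl
  simp [hrepr, two_mul]

lemma trace_real_mulLeft (Z : Matrix ι ι ℂ) :
    LinearMap.trace ℝ _ (LinearMap.mulLeft ℝ Z) = 2 * Fintype.card ι * Z.trace.re := by
  refine (trace_real_eq (LinearMap.mulLeft ℂ Z)).trans ?_
  simp [Fintype.sum_prod_type, Matrix.trace, Finset.mul_sum, mul_assoc]

lemma trace_real_mulRight (Z : Matrix ι ι ℂ) :
    LinearMap.trace ℝ _ (LinearMap.mulRight ℝ Z) = 2 * Fintype.card ι * Z.trace.re := by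
  refine (trace_real_eq (LinearMap.mulRight ℂ Z)).trans ?_
  simp [Fintype.sum_prod_type, Matrix.trace, Finset.mul_sum, mul_assoc]

end RealTrace

/-! ### The space of functions `φ_a`: dimension and smoothness. -/

section Family
variable {n : ℕ}

/-- The linear map `a ↦ φ_a`. -/
def familyMap (v : Fin n → ℂ) : (Fin n → ℂ) →ₗ[ℂ] (GLC n → ℂ) where
  toFun a z := (Matrix.vecMulVec v a * (MatC.toMatrix (z : MatC n))ᵀ).trace
  map_add' a b := by ext z; simp [Matrix.vecMulVec_add, add_mul]
  map_smul' c a := by ext z; simp [Matrix.vecMulVec_smul]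

lemma familyMap_apply (v a : Fin n → ℂ) (z : GLC n) : familyMap v a z =
    (Matrix.vecMulVec a v * MatC.toMatrix (z : MatC n)).trace := by
  change (Matrix.vecMulVec v a * (MatC.toMatrix (z : MatC n))ᵀ).trace = _
  rw [← Matrix.trace_transpose, Matrix.transpose_mul, Matrix.transpose_transpose,
    Matrix.trace_mul_comm, Matrix.transpose_vecMulVec]

lemma coe_range_familyMap (v : Fin n → ℂ) :
    (LinearMap.range (familyMap v) : Set (GLC n → ℂ)) = glFamily n v := rfl

/-- Only invertible arguments are available. With `v i ≠ 0`, subtracting the value at `1` from the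
value at the transvection `1 + E_{ij}` isolates `a j * v i` for `j ≠ i`; the value at `1` then
reduces to `a i * v i`. -/
lemma familyMap_injective {v : Fin n → ℂ} (hv : v ≠ 0) : Function.Injective (familyMap v) := by
  rw [← LinearMap.ker_eq_bot, LinearMap.ker_eq_bot']
  intro a ha
  have h1 (Z : Matrix (Fin n) (Fin n) ℂ) (hZ : IsUnit Z) :
      (Matrix.vecMulVec a v * Z).trace = 0 := by
    have hu : IsUnit (MatC.toMatrix.symm Z) := hZ.map MatC.toMatrix.symm
    simpa [familyMap_apply] using congrFun ha hu.unit
  obtain ⟨i, hi⟩ := Function.ne_iff.1 hv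
  replace hi : v i ≠ 0 := hi
  have hone := h1 1 isUnit_one
  have hoff (j : Fin n) (hj : j ≠ i) : a j = 0 := by
    have h2 := h1 (Matrix.transvection i j 1) <| by
      rw [Matrix.isUnit_iff_isUnit_det, Matrix.det_transvection_of_ne _ _ hj.symm]
      exact isUnit_one
    rw [Matrix.transvection, mul_add, Matrix.trace_add, hone, zero_add,
      Matrix.trace_mul_single] at h2
    simpa [Matrix.vecMulVec_apply, hi] using h2
  ext j
  by_cases hj : j = i
  · subst hj
    rw [mul_one, Matrix.trace, Finset.sum_eq_single j (by
      intro k _ hk; simp [Matrix.vecMulVec_apply, hoff k hk]) (by simp)] at hone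
    simpa [Matrix.vecMulVec_apply, hi] using hone
  · exact hoff j hj

lemma finrank_range_familyMap {v : Fin n → ℂ} (hv : v ≠ 0) :
    Module.finrank ℂ (LinearMap.range (familyMap v)) = n := by
  rw [LinearMap.finrank_range_of_inj (familyMap_injective hv), Module.finrank_fin_fun]

lemma contMDiff_familyMap (v a : Fin n → ℂ) :
    ContMDiff 𝓘(ℝ, MatC n) 𝓘(ℝ, ℂ) ∞ (familyMap v a) := by
  let L : MatC n →ₗ[ℝ] ℂ :=
    (Matrix.traceLinearMap (Fin n) ℝ ℂ).comp
      ((LinearMap.mulLeft ℝ (Matrix.vecMulVec a v)).comp MatC.toMatrix.toLinearMap)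
  have h : familyMap v a = L ∘ (Units.val : GLC n → MatC n) := by
    ext z; exact familyMap_apply v a z
  rw [h]
  exact (LinearMap.toContinuousLinearMap L).contMDiff.comp Units.contMDiff_val

end Family

/-! ### Tension and conformality of the functions `φ_a`. -/

section GeneralLinear

variable {n : ℕ}

lemma glForm_mul_assoc (X Y Z : MatC n) : glForm n (X * Y) Z = glForm n X (Y * Z) := by
  rw [glForm_apply, glForm_apply, mul_assoc]

lemma leftTrace_matC (Z : MatC n) : leftTrace Z = 2 * n * (MatC.toMatrix Z).trace.re := by
  have h := trace_real_mulLeft (MatC.toMatrix Z)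
  rw [Fintype.card_fin] at h
  exact h

lemma trace_mulRight_matC (Z : MatC n) :
    LinearMap.trace ℝ (MatC n) (LinearMap.mulRight ℝ Z) =
      2 * n * (MatC.toMatrix Z).trace.re := by
  have h := trace_real_mulRight (MatC.toMatrix Z)
  rw [Fintype.card_fin] at h
  exact h

/-- Multiplication of a complex matrix by a scalar, in `MatC n`. -/
def scaledMatrix (c : ℂ) (N : Matrix (Fin n) (Fin n) ℂ) : MatC n := MatC.toMatrix.symm (c • N)

lemma toMatrix_scaledMatrix (c : ℂ) (N : Matrix (Fin n) (Fin n) ℂ) :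
    MatC.toMatrix (scaledMatrix c N) = c • N := rfl

/-- Put `w = tr(NX)`. The form is minus a real part, so `-N` yields `Re w` and `iN` yields `-Re(iw)
= Im w`. -/
lemma trace_eq_glForm (N : Matrix (Fin n) (Fin n) ℂ) (X : MatC n) :
    (N * MatC.toMatrix X).trace = (glForm n (scaledMatrix (-1) N) X : ℂ) +
      Complex.I * (glForm n (scaledMatrix Complex.I N) X : ℂ) := by
  apply Complex.ext <;>
  simp [glForm_apply, toMatrix_scaledMatrix]

lemma isGradient_familyMap (v a : Fin n → ℂ) :
    IsGradient (glForm n) (familyMap v a)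
      (fun z ↦ z * scaledMatrix (-1) (Matrix.vecMulVec a v) * z)
      (fun z ↦ z * scaledMatrix Complex.I (Matrix.vecMulVec a v) * z) :=
  isGradient_of_linear glForm_mul_assoc _ _ _ fun z ↦ by
    rw [familyMap_apply, trace_eq_glForm]

/-- Since `p⁻¹(pMp) = Mp` and `tr(pM) = tr(Mp)`, the two left-multiplication traces cancel and only
that of right multiplication by `Mp` survives. -/
lemma trace_deriv_sub_leftTrace (p : GLC n) (M : MatC n) :
    LinearMap.trace ℝ (MatC n) ((ContinuousLinearMap.mul ℝ (MatC n)) (p * M) +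
      (ContinuousLinearMap.mul ℝ (MatC n)).flip (M * p) : MatC n →L[ℝ] MatC n) -
      leftTrace (p⁻¹.val * (p * M * p)) =
      2 * n * (MatC.toMatrix M * MatC.toMatrix (p : MatC n)).trace.re := by
  rw [trace_deriv_mul_mul, ← leftTrace_apply, leftTrace_matC, trace_mulRight_matC, mul_assoc (p : MatC n) M,
    Units.inv_mul_cancel_left, leftTrace_matC, map_mul, map_mul, Matrix.trace_mul_comm]
  ring

theorem tension_familyMap (v a : Fin n → ℂ) (p : GLC n) :
    (glMetric n).tension (familyMap v a) p = -2 * (n : ℂ) * familyMap v a p := by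
  refine ((isGradient_familyMap v a).tension (glForm_symm n) (glForm_nondegenerate n) p
    (hasFDerivAt_mul_mul _ _) (hasFDerivAt_mul_mul _ _)).trans ?_
  rw [trace_deriv_sub_leftTrace, trace_deriv_sub_leftTrace, familyMap_apply,
    toMatrix_scaledMatrix, toMatrix_scaledMatrix]
  apply Complex.ext <;> simp

lemma fderiv_familyMap (v a : Fin n → ℂ) (p : GLC n) (X : MatC n) :
    fderiv ℝ (familyMap v a ∘ (chartAt (MatC n) p).symm) (p : MatC n) X =
      (Matrix.vecMulVec a v * MatC.toMatrix X).trace := by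
  have h (K : MatC n) : glForm n (p⁻¹.val * (p * K * p)) (p⁻¹.val * X) = glForm n K X := by
    rw [mul_assoc, Units.inv_mul_cancel_left, glForm_mul_assoc, Units.mul_inv_cancel_left]
  rw [isGradient_familyMap v a p p X, trace_eq_glForm, h, h]

/-- The middle of `c (v z a) v z` is a scalar, which splits off; this uses that both rank-one
matrices share the row `v`. -/
lemma trace_vecMulVec_sandwich (v a c : Fin n → ℂ) (z : Matrix (Fin n) (Fin n) ℂ) :
    (Matrix.vecMulVec c v * (z * Matrix.vecMulVec a v * z)).trace =
      (Matrix.vecMulVec a v * z).trace * (Matrix.vecMulVec c v * z).trace := by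
  rw [Matrix.mul_vecMulVec, Matrix.vecMulVec_mul (z *ᵥ a), Matrix.vecMulVec_mul_vecMulVec,
    Matrix.vecMulVec_mul a, Matrix.vecMulVec_mul c]
  simp only [Matrix.trace_vecMulVec, dotProduct_smul, smul_eq_mul, dotProduct_comm a,
    Matrix.dotProduct_mulVec]

theorem conformality_familyMap (v a c : Fin n → ℂ) (p : GLC n) :
    (glMetric n).conformality (familyMap v a) (familyMap v c) p =
      -2 * familyMap v a p * familyMap v c p := by
  refine ((isGradient_familyMap v a).conformality (glForm_symm n) (glForm_nondegenerate n)
    (isGradient_familyMap v c) p).trans ?_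
  rw [fderiv_familyMap, fderiv_familyMap]
  simp only [map_mul, toMatrix_scaledMatrix, mul_smul_comm, smul_mul_assoc, Matrix.trace_smul,
    smul_eq_mul, trace_vecMulVec_sandwich, familyMap_apply]
  -- The real part of the gradient contributes `-1` and the imaginary part `i * i = -1`, whence the
  -- constant `-2`.
  linear_combination (Matrix.vecMulVec a v * MatC.toMatrix (p : MatC n)).trace *
    (Matrix.vecMulVec c v * MatC.toMatrix (p : MatC n)).trace * Complex.I_mul_I

end GeneralLinear

end UnitsMetric

end

open UnitsMetric in
theorem theorem5p3 (n : ℕ) (v : Fin n → ℂ) (hv : v ≠ 0) :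
    (∃ W : Submodule ℂ (GLC n → ℂ),
      (W : Set (GLC n → ℂ)) = glFamily n v ∧ Module.finrank ℂ W = n) ∧
    (glMetric n).IsEigenfamily (glFamily n v) ∧
    ∀ φ ∈ glFamily n v, ∀ ψ ∈ glFamily n v,
      (∀ p, (glMetric n).tension φ p = -2 * (n : ℂ) * φ p) ∧
      (∀ p, (glMetric n).conformality φ ψ p = -2 * φ p * ψ p) := by
  have h : ∀ φ ∈ glFamily n v, ∀ ψ ∈ glFamily n v,
      (∀ p, (glMetric n).tension φ p = -2 * (n : ℂ) * φ p) ∧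
      (∀ p, (glMetric n).conformality φ ψ p = -2 * φ p * ψ p) := by
    rintro _ ⟨a, rfl⟩ _ ⟨c, rfl⟩
    exact ⟨tension_familyMap v a, conformality_familyMap v a c⟩
  refine ⟨⟨LinearMap.range (familyMap v), coe_range_familyMap v, finrank_range_familyMap hv⟩,
    ⟨?_, -2 * n, -2, h⟩, h⟩
  rintro _ ⟨a, rfl⟩
  exact contMDiff_familyMap v a
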